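/- Let $\mathcal I$ be a finite index set and, for each $i\in\mathcal I$, let $\mathcal J_i$ be a finite index set. Let $C_{i,j}\subset\mathbb R^d$ ($i\in\mathcal I$, $j\in\mathcal J_i$) be pairwise disjoint bounded closed convex sets, put $C_i=\operatorname{conv}\big(\bigcup_{j\in\mathcal J_i}C_{i,j}\big)$, and assume that the sets $C_i$ ($i\in\mathcal I$) are pairwise disjoint. Let $S\subset\mathbb R^d$ be bounded, closed and convex. Then there exist $t_1\in(0,1)$ and $t_2\in(t_1,1)$, depending only on $S$ and the $C_{i,j}$, such that the following holds. (a) For every $t\in(t_1,1]$ the convex sets $(1-t)S+tC_i$, $i\in\mathcal I$, are pairwise disjoint. (b) For every $t\in(t_2,1]$ the convex sets $(1-t)S+tC_{i,j}$, $i\in\mathcal I$, $j\in\mathcal J_i$, are pairwise disjoint. (c) Let $p_0,p_1$ be Borel probability measures on $\mathbb R^d$ with $p_0(S)=1$ and $p_1\big(\bigcup_{i,j}C_{i,j}\big)=1$. An optimal velocity field under the optimal transport (OT) paths is a Borel field $v:\mathbb R\times\mathbb R^d\to\mathbb R^d$ that minimizes, among all Borel fields, the conditional flow matching loss $$\mathcal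 L(v)=\mathbb E_{t\sim\mathcal U[0,1],\,x_1\sim p_1,\,x_0\sim p_0}\big\|v_t((1-t)x_0+tx_1)-(x_1-x_0)\big\|_2^2 ,$$ where $t,x_0,x_1$ are independent. Let $\phi$ be an optimal flow, i.e. the flow of the optimal velocity field: for every such minimizer $v$ (minimizers are unique only up to null sets) and $p_0$-almost every $x$, the function $s\mapsto v_s(\phi_s(x))$ is integrable on $[0,1]$ and $\phi_t(x)=x+\int_0^t v_s(\phi_s(x))\,\mathrm ds$ for all $t\in[0,1]$. Then for $p_0$-almost every $x$: - for every $i\in\mathcal I$, if $\phi_{t_1}(x)\in(1-t_1)S+t_1C_i$, then $\phi_t(x)\in(1-t)S+tC_i$ for all $t\in(t_1,1]$; in particular $\phi_1(x)\in C_i$; - for every $i\in\mathcal I$, $j\in\mathcal J_i$, if $\phi_{t_2}(x)\in(1-t_2)S+t_2C_{i,j}$, then $\phi_t(x)\in(1-t)S+tC_{i,j}$ for all $t\in(t_2,1]$; in particular $\phi_1(x)\in C_{i,j}$. -/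

import Mathlib

open MeasureTheory Set
open scoped ENNReal Pointwise

namespace FlowMatching

/-- Linear interpolation `(1 - t) x₀ + t x₁`: the OT conditional flow, conditioned on `x₁`. -/
noncomputable def otInterp {d : ℕ} (t : ℝ) (x₀ x₁ : EuclideanSpace ℝ (Fin d)) :
    EuclideanSpace ℝ (Fin d) :=
  (1 - t) • x₀ + t • x₁

/-- The Conditional Flow Matching loss of a time-dependent velocity field `v` for OT paths,
`E ‖v_t((1 - t) x₀ + t x₁) - (x₁ - x₀)‖²` with `t` uniform on `[0, 1]`, `x₀ ∼ p₀`, `x₁ ∼ p₁`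
independent. -/
noncomputable def cfmLoss {d : ℕ} (p₀ p₁ : Measure (EuclideanSpace ℝ (Fin d)))
    (v : ℝ → EuclideanSpace ℝ (Fin d) → EuclideanSpace ℝ (Fin d)) : ℝ≥0∞ :=
  ∫⁻ t in Icc (0 : ℝ) 1, ∫⁻ x₁, ∫⁻ x₀,
    ‖v t (otInterp t x₀ x₁) - (x₁ - x₀)‖ₑ ^ 2 ∂p₀ ∂p₁

/-- `v` is an optimal velocity field for OT paths: it minimizes the CFM loss over all (jointly
Borel measurable) time-dependent velocity fields. -/
def IsOptimalVelocity {d : ℕ} (p₀ p₁ : Measure (EuclideanSpace ℝ (Fin d)))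
    (v : ℝ → EuclideanSpace ℝ (Fin d) → EuclideanSpace ℝ (Fin d)) : Prop :=
  Measurable (Function.uncurry v) ∧
    ∀ w : ℝ → EuclideanSpace ℝ (Fin d) → EuclideanSpace ℝ (Fin d),
      Measurable (Function.uncurry w) → cfmLoss p₀ p₁ v ≤ cfmLoss p₀ p₁ w

/-- The curve `γ` solves `γ' (t) = v_t (γ t)` on `[0, 1]` with `γ 0 = x`, in the
(Carathéodory) integral sense; in particular `γ` is absolutely continuous on `[0, 1]`. -/
def SolvesODE {d : ℕ} (v : ℝ → EuclideanSpace ℝ (Fin d) → EuclideanSpace ℝ (Fin d))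
    (x : EuclideanSpace ℝ (Fin d)) (γ : ℝ → EuclideanSpace ℝ (Fin d)) : Prop :=
  IntervalIntegrable (fun s => v s (γ s)) volume 0 1 ∧
    ∀ t ∈ Icc (0 : ℝ) 1, γ t = x + ∫ s in (0 : ℝ)..t, v s (γ s)

/-- `φ` is an optimal flow for OT paths: the flow of the optimal velocity field, started from
`p₀`-almost every point. The loss determines the optimal velocity field only up to a null set of
pairs (time, position) under the interpolation law, so being a flow of it must not depend on the
representative: the ODE is required for each minimizer, the exceptional `p₀`-null set of starting
points being allowed to depend on the minimizer. -/
def IsOptimalFlow {d : ℕ} (p₀ p₁ : Measure (EuclideanSpace ℝ (Fin d)))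
    (φ : ℝ → EuclideanSpace ℝ (Fin d) → EuclideanSpace ℝ (Fin d)) : Prop :=
  ∀ v, IsOptimalVelocity p₀ p₁ v → ∀ᵐ x ∂p₀, SolvesODE v x (fun t => φ t x)

/-- The set `(1 - t) S + t C` (scalar multiple and Minkowski sum). -/
def region {d : ℕ} (S C : Set (EuclideanSpace ℝ (Fin d))) (t : ℝ) :
    Set (EuclideanSpace ℝ (Fin d)) :=
  (1 - t) • S + t • C

/-- The group hull `C_i = conv (⋃_j C_{i,j})`. -/
def groupHull {d : ℕ} {I : Type*} {J : I → Type*}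
    (C : (i : I) → J i → Set (EuclideanSpace ℝ (Fin d))) (i : I) :
    Set (EuclideanSpace ℝ (Fin d)) :=
  convexHull ℝ (⋃ j, C i j)

end FlowMatching

/-!
The curves `t ↦ φ t x` are confined for a reason that is topological rather than dynamical.

*Null sets are avoided.* Let `X_t = (1 - t) X₀ + t X₁`. The flow matching loss of `v` is the squared
`L²` distance from `v (t, X_t)` to `X₁ - X₀`, so a minimizer exists by orthogonal projection onto the
closed subspace of functions of `(t, X_t)` (`exists_minimizer_eLpNorm_comp_sub`), and changing a
minimizer on a null set of the law of `(t, X_t)` yields another minimizer. An optimal flow solves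
the ODE for all of them. Comparing a minimizer `v` with `v + e` on a null set `N`, `e ≠ 0`, one finds
that almost every curve spends no time in `N` (`IsOptimalFlow.ae_ae_notMem`).

*The tube.* Apply this to the complement of `{(t, y) | t ∈ [0, 1], y ∈ (1 - t) S + t ⋃ C_{i,j}}`,
which is compact and carries the law of `(t, X_t)`. Curves are continuous, so almost every
one lies in this tube at every time (`IsOptimalFlow.ae_forall_mem_region`).

*Connectedness.* By compactness, for `t` close enough to `1` the regions `(1 - t) S + t K_k` of
finitely many pairwise disjoint compact sets `K_k` are pairwise disjoint
(`eventually_pairwise_disjoint_region`). On such an interval `[τ, 1]` the tube splits into finitely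
many disjoint closed pieces, one for each `k`, and a continuous curve in the tube cannot change pieces
(`mem_region_of_continuousOn`). This is used with the hulls `C_i` for `t₁` and with the sets
`C_{i,j}` for `t₂`.
-/

namespace FlowMatching

/-! ### Compactness of convex hulls -/

theorem isCompact_convexJoin {E : Type*} [AddCommGroup E] [Module ℝ E] [TopologicalSpace E]
    [ContinuousAdd E] [ContinuousSMul ℝ E] {A B : Set E} (hA : IsCompact A) (hB : IsCompact B) :
    IsCompact (convexJoin ℝ A B) := by
  have h : convexJoin ℝ A B =
      (fun z : ℝ × E × E => (1 - z.1) • z.2.1 + z.1 • z.2.2) '' (Icc (0 : ℝ) 1 ×ˢ A ×ˢ B) := by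
    ext x
    simp only [mem_convexJoin, segment_eq_image, mem_image, mem_prod, Prod.exists]
    constructor
    · rintro ⟨a, ha, b, hb, t, ht, rfl⟩
      exact ⟨t, a, b, ⟨ht, ha, hb⟩, rfl⟩
    · rintro ⟨t, a, b, ⟨ht, ha, hb⟩, rfl⟩
      exact ⟨a, ha, b, hb, t, ht, rfl⟩
  rw [h]
  exact (isCompact_Icc.prod (hA.prod hB)).image (by fun_prop)

theorem isCompact_convexHull_iUnion {E : Type*} [AddCommGroup E] [Module ℝ E]
    [TopologicalSpace E] [ContinuousAdd E] [ContinuousSMul ℝ E] {J : Type*} [Finite J]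
    {C : J → Set E} (hC : ∀ j, IsCompact (C j)) (hconv : ∀ j, Convex ℝ (C j)) :
    IsCompact (convexHull ℝ (⋃ j, C j)) := by
  classical
  suffices h : ∀ s : Finset J, IsCompact (convexHull ℝ (⋃ j ∈ s, C j)) by
    have := Fintype.ofFinite J
    simpa using h Finset.univ
  intro s
  induction s using Finset.induction_on with
  | empty => simp
  | insert a s _ ih =>
    rw [Finset.set_biUnion_insert, ← convexHull_convexHull_union_right]
    rcases (C a).eq_empty_or_nonempty with ha | ha
    · rw [ha, empty_union, (convex_convexHull ℝ _).convexHull_eq]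
      exact ih
    rcases (convexHull ℝ (⋃ j ∈ s, C j)).eq_empty_or_nonempty with hs | hs
    · rw [hs, union_empty, (hconv a).convexHull_eq]
      exact hC a
    rw [(hconv a).convexHull_union (convex_convexHull ℝ _) ha hs]
    exact isCompact_convexJoin (hC a) ih

/-! ### The regions `(1 - t) S + t C` -/

variable {d : ℕ}

theorem mem_region {S C : Set (EuclideanSpace ℝ (Fin d))} {t : ℝ}
    {y : EuclideanSpace ℝ (Fin d)} :
    y ∈ region S C t ↔ ∃ x₀ ∈ S, ∃ x₁ ∈ C, otInterp t x₀ x₁ = y := by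
  simp only [region, otInterp, mem_add, mem_smul_set]
  aesop

theorem convex_region {S C : Set (EuclideanSpace ℝ (Fin d))} (hS : Convex ℝ S)
    (hC : Convex ℝ C) (t : ℝ) : Convex ℝ (region S C t) :=
  (hS.smul _).add (hC.smul _)

theorem region_mono {S C C' : Set (EuclideanSpace ℝ (Fin d))} (h : C ⊆ C') (t : ℝ) :
    region S C t ⊆ region S C' t :=
  add_subset_add_left (smul_set_mono h)

theorem region_iUnion {ι : Sort*} (S : Set (EuclideanSpace ℝ (Fin d)))
    (C : ι → Set (EuclideanSpace ℝ (Fin d))) (t : ℝ) :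
    region S (⋃ k, C k) t = ⋃ k, region S (C k) t := by
  simp only [region, smul_set_iUnion, add_iUnion]

theorem region_one_subset (S C : Set (EuclideanSpace ℝ (Fin d))) : region S C 1 ⊆ C := by
  intro y hy
  obtain ⟨x₀, -, x₁, h₁, rfl⟩ := mem_region.1 hy
  simpa [otInterp] using h₁

/-- The space-time tube swept out by the regions `(1 - t) S + t C` for `t ∈ [0, 1]`. -/
def tube (S C : Set (EuclideanSpace ℝ (Fin d))) : Set (ℝ × EuclideanSpace ℝ (Fin d)) :=
  {z | z.1 ∈ Icc (0 : ℝ) 1 ∧ z.2 ∈ region S C z.1}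

theorem isCompact_tube {S C : Set (EuclideanSpace ℝ (Fin d))} (hS : IsCompact S)
    (hC : IsCompact C) : IsCompact (tube S C) := by
  have h : tube S C = (fun z : ℝ × EuclideanSpace ℝ (Fin d) × EuclideanSpace ℝ (Fin d) =>
      (z.1, otInterp z.1 z.2.1 z.2.2)) '' (Icc (0 : ℝ) 1 ×ˢ S ×ˢ C) := by
    ext ⟨t, y⟩
    simp only [tube, mem_ofPred_eq, mem_region, mem_image, mem_prod, Prod.exists, Prod.mk.injEq]
    constructor
    · rintro ⟨ht, x₀, h₀, x₁, h₁, rfl⟩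
      exact ⟨t, x₀, x₁, ⟨ht, h₀, h₁⟩, rfl, rfl⟩
    · rintro ⟨t, x₀, x₁, ⟨ht, h₀, h₁⟩, rfl, rfl⟩
      exact ⟨ht, x₀, h₀, x₁, h₁, rfl⟩
  rw [h]
  refine (isCompact_Icc.prod (hS.prod hC)).image ?_
  unfold otInterp
  fun_prop

theorem eventually_disjoint_region {S A B : Set (EuclideanSpace ℝ (Fin d))} (hS : IsCompact S)
    (hA : IsCompact A) (hB : IsCompact B) (hAB : Disjoint A B) :
    ∀ᶠ t in nhds (1 : ℝ), Disjoint (region S A t) (region S B t) := by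
  have key := ((hS.prod hA).prod (hS.prod hB)).eventually_forall_of_forall_eventually
    (x₀ := (1 : ℝ)) (P := fun t z => otInterp t z.1.1 z.1.2 ≠ otInterp t z.2.1 z.2.2) <| by
      rintro ⟨⟨s, a⟩, ⟨s', b⟩⟩ ⟨⟨-, ha⟩, ⟨-, hb⟩⟩
      have hc : Continuous fun z : ℝ ×
          ((EuclideanSpace ℝ (Fin d) × EuclideanSpace ℝ (Fin d)) ×
            (EuclideanSpace ℝ (Fin d) × EuclideanSpace ℝ (Fin d))) =>
          otInterp z.1 z.2.1.1 z.2.1.2 - otInterp z.1 z.2.2.1 z.2.2.2 := by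
        unfold otInterp
        fun_prop
      have hne : a - b ≠ 0 := sub_ne_zero.2 (hAB.ne_of_mem ha hb)
      filter_upwards [hc.continuousAt.eventually_ne (x := ((1 : ℝ), ((s, a), (s', b))))
        (y := 0) (by simpa [otInterp] using hne)] with z hz
      exact sub_ne_zero.1 hz
  filter_upwards [key] with t ht
  rw [Set.disjoint_left]
  intro y hy hy'
  obtain ⟨s, hs, a, ha, rfl⟩ := mem_region.1 hy
  obtain ⟨s', hs', b, hb, h⟩ := mem_region.1 hy'
  exact ht ((s, a), (s', b)) ⟨⟨hs, ha⟩, ⟨hs', hb⟩⟩ h.symm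

theorem eventually_pairwise_disjoint_region {ι : Type*} [Finite ι]
    {S : Set (EuclideanSpace ℝ (Fin d))} (hS : IsCompact S)
    {K : ι → Set (EuclideanSpace ℝ (Fin d))} (hK : ∀ k, IsCompact (K k))
    (hdisj : Pairwise fun k l => Disjoint (K k) (K l)) :
    ∀ᶠ t in nhds (1 : ℝ), Pairwise fun k l => Disjoint (region S (K k) t) (region S (K l) t) := by
  unfold Pairwise
  simp only [Filter.eventually_all]
  exact fun k l hkl => eventually_disjoint_region hS (hK k) (hK l) (hdisj hkl)

theorem exists_forall_Icc_of_eventually_nhds_one {P : ℝ → Prop}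
    (h : ∀ᶠ t in nhds (1 : ℝ), P t) {a : ℝ} (ha : a < 1) :
    ∃ τ ∈ Ioo a 1, ∀ t ∈ Icc τ 1, P t := by
  obtain ⟨ε, hε, hP⟩ := Metric.eventually_nhds_iff.1 h
  have h1 : max a (1 - ε) < 1 := max_lt ha (by linarith)
  obtain ⟨τ, hτ, hτ1⟩ := exists_between h1
  refine ⟨τ, ⟨(le_max_left _ _).trans_lt hτ, hτ1⟩, fun t ht => hP ?_⟩
  have h2 := (le_max_right a (1 - ε)).trans_lt hτ
  rw [Real.dist_eq, abs_lt]
  constructor <;> linarith [ht.1, ht.2]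

/-! ### Curves in the tube -/

/-- While the regions of a finite family of compact sets are pairwise disjoint, a continuous curve
in the union of the regions cannot pass from one to another: the times spent in one region and the
times spent in the others form a separation of a time interval into closed sets. -/
theorem mem_region_of_continuousOn {ι : Type*} [Finite ι]
    {S : Set (EuclideanSpace ℝ (Fin d))} (hS : IsCompact S)
    {K : ι → Set (EuclideanSpace ℝ (Fin d))} (hK : ∀ k, IsCompact (K k)) {τ : ℝ} (hτ : 0 ≤ τ)
    (hdisj : ∀ t ∈ Icc τ 1, Pairwise fun k l => Disjoint (region S (K k) t) (region S (K l) t))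
    {γ : ℝ → EuclideanSpace ℝ (Fin d)} (hγ : ContinuousOn γ (Icc 0 1))
    (hmem : ∀ t ∈ Icc (0 : ℝ) 1, γ t ∈ region S (⋃ k, K k) t) {k : ι}
    (hk : γ τ ∈ region S (K k) τ) {t : ℝ} (ht : t ∈ Icc τ 1) : γ t ∈ region S (K k) t := by
  have hsub : Icc τ 1 ⊆ Icc (0 : ℝ) 1 := Icc_subset_Icc_left hτ
  have hgraph : ContinuousOn (fun s => (s, γ s)) (Icc τ 1) :=
    continuousOn_id.prodMk (hγ.mono hsub)
  have hclosed : ∀ L : Set (EuclideanSpace ℝ (Fin d)), IsCompact L →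
      IsClosed (Icc τ 1 ∩ {s | γ s ∈ region S L s}) := by
    intro L hL
    convert hgraph.preimage_isClosed_of_isClosed isClosed_Icc (isCompact_tube hS hL).isClosed
      using 1
    ext s
    simp only [tube, mem_inter_iff, mem_ofPred_eq, mem_preimage]
    exact ⟨fun h => ⟨h.1, hsub h.1, h.2⟩, fun h => ⟨h.1, h.2.2⟩⟩
  have hτ' : τ ∈ Icc τ 1 := ⟨le_rfl, ht.1.trans ht.2⟩
  by_contra hcon
  have hcover : ∀ s ∈ Icc τ 1, γ s ∈ region S (K k) s ∨
      γ s ∈ region S (⋃ l : {l // l ≠ k}, K l) s := by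
    intro s hs
    have h := hmem s (hsub hs)
    rw [region_iUnion] at h ⊢
    obtain ⟨l, hl⟩ := mem_iUnion.1 h
    by_cases hlk : l = k
    · exact Or.inl (hlk ▸ hl)
    · exact Or.inr (mem_iUnion.2 ⟨⟨l, hlk⟩, hl⟩)
  obtain ⟨s, -, ⟨hs, hs₁⟩, -, hs₂⟩ :=
    isPreconnected_closed_iff.1 (isPreconnected_Icc (a := τ) (b := (1 : ℝ))) _ _
      (hclosed (K k) (hK k)) (hclosed (⋃ l : {l // l ≠ k}, K l) (isCompact_iUnion fun l => hK l))
      (fun s hs => (hcover s hs).imp (fun h => ⟨hs, h⟩) (fun h => ⟨hs, h⟩))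
      ⟨τ, hτ', hτ', hk⟩ ⟨t, ht, ht, (hcover t ht).resolve_left hcon⟩
  simp only [mem_ofPred_eq, region_iUnion, mem_iUnion] at hs₁ hs₂
  obtain ⟨⟨l, hl⟩, hsl⟩ := hs₂
  exact Set.disjoint_left.1 (hdisj s hs hl) hsl hs₁

theorem SolvesODE.continuousOn {v : ℝ → EuclideanSpace ℝ (Fin d) → EuclideanSpace ℝ (Fin d)}
    {x : EuclideanSpace ℝ (Fin d)} {γ : ℝ → EuclideanSpace ℝ (Fin d)} (h : SolvesODE v x γ) :
    ContinuousOn γ (Icc 0 1) := by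
  have hint : IntegrableOn (fun s => v s (γ s)) (uIcc 0 1) := by
    rw [uIcc_of_le zero_le_one, integrableOn_Icc_iff_integrableOn_Ioc]
    exact (intervalIntegrable_iff_integrableOn_Ioc_of_le zero_le_one).1 h.1
  have hc := intervalIntegral.continuousOn_primitive_interval hint
  rw [uIcc_of_le zero_le_one] at hc
  exact (continuousOn_const.add hc).congr h.2

/-- A closed condition on the graph of a continuous curve that holds at almost every time holds at
every time. -/
theorem forall_mem_of_ae_mem_of_isClosed {X : Type*} [TopologicalSpace X] {γ : ℝ → X}
    (hγ : ContinuousOn γ (Icc 0 1)) {F : Set (ℝ × X)} (hF : IsClosed F)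
    (h : ∀ᵐ s ∂volume.restrict (Icc (0 : ℝ) 1), (s, γ s) ∈ F) :
    ∀ t ∈ Icc (0 : ℝ) 1, (t, γ t) ∈ F := by
  have hclosed : IsClosed (Icc (0 : ℝ) 1 ∩ (fun s => (s, γ s)) ⁻¹' F) :=
    (continuousOn_id.prodMk hγ).preimage_isClosed_of_isClosed isClosed_Icc hF
  -- A relatively open set of bad times in `(0, 1)` would have positive length.
  have hIoo : Ioo (0 : ℝ) 1 ⊆ Icc (0 : ℝ) 1 ∩ (fun s => (s, γ s)) ⁻¹' F := by
    intro t ht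
    by_contra hcon
    have hopen : IsOpen (Ioo (0 : ℝ) 1 \ (Icc (0 : ℝ) 1 ∩ (fun s => (s, γ s)) ⁻¹' F)) :=
      isOpen_Ioo.sdiff hclosed
    refine (hopen.measure_pos volume ⟨t, ht, hcon⟩).ne' (measure_mono_null ?_
      ((ae_restrict_iff' measurableSet_Icc).1 h))
    intro s hs hs'
    exact hs.2 ⟨Ioo_subset_Icc_self hs.1, hs' (Ioo_subset_Icc_self hs.1)⟩
  intro t ht
  rw [← closure_Ioo zero_ne_one] at ht
  exact (closure_minimal hIoo hclosed ht).2

/-! ### Minimizers of the flow matching loss -/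

/-- The `L²` projection of `f` onto the functions of `T`: the functions `w ∘ T` in `L²` are the range
of an isometry defined on a complete space, hence a complete subspace, so that one of them is
closest to `f`. -/
theorem exists_minimizer_eLpNorm_comp_sub {α β E : Type*} [MeasurableSpace α]
    [MeasurableSpace β] [NormedAddCommGroup E] [InnerProductSpace ℝ E] [CompleteSpace E]
    [SecondCountableTopology E] [MeasurableSpace E] [BorelSpace E] {μ : Measure α} {T : α → β}
    (hT : Measurable T) {f : α → E} (hf : MemLp f 2 μ) :
    ∃ v : β → E, Measurable v ∧ ∀ w : β → E, Measurable w →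
      eLpNorm (v ∘ T - f) 2 μ ≤ eLpNorm (w ∘ T - f) 2 μ := by
  have hT' : MeasurePreserving T μ (μ.map T) := ⟨hT, rfl⟩
  let L := Lp.compMeasurePreservingₗᵢ (E := E) (p := 2) ℝ T hT'
  have hcomplete : IsComplete (L.toLinearMap.range : Set (Lp E 2 μ)) := by
    rw [LinearMap.coe_range]
    exact L.isometry.isUniformInducing.isComplete_range
  obtain ⟨u, ⟨g, rfl⟩, hu⟩ :=
    L.toLinearMap.range.exists_norm_eq_iInf_of_complete_subspace hcomplete (hf.toLp f)
  have hmin : ∀ g', ‖L g - hf.toLp f‖ₑ ≤ ‖L g' - hf.toLp f‖ₑ := by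
    intro g'
    rw [enorm_le_iff_norm_le, norm_sub_rev, norm_sub_rev (L g')]
    refine hu.trans_le (ciInf_le (f := fun w : (L.toLinearMap.range : Set (Lp E 2 μ)) =>
      ‖hf.toLp f - w‖) ⟨0, ?_⟩ ⟨L g', g', rfl⟩)
    rintro _ ⟨w, rfl⟩
    exact norm_nonneg _
  have hL : ∀ w : β → E, ∀ g' : Lp E 2 (μ.map T), g' =ᵐ[μ.map T] w →
      ‖L g' - hf.toLp f‖ₑ = eLpNorm (w ∘ T - f) 2 μ := by
    intro w g' hw
    rw [Lp.enorm_def]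
    refine eLpNorm_congr_ae ((Lp.coeFn_sub _ _).trans (Filter.EventuallyEq.sub ?_ hf.coeFn_toLp))
    exact (Lp.coeFn_compMeasurePreserving g' hT').trans (hT'.quasiMeasurePreserving.ae_eq hw)
  refine ⟨g, (Lp.stronglyMeasurable g).measurable, fun w hw => ?_⟩
  by_cases hfin : MemLp (w ∘ T - f) 2 μ
  · have hwT : MemLp (w ∘ T) 2 μ := by simpa using hfin.add hf
    have hwL : MemLp w 2 (μ.map T) :=
      (memLp_map_measure_iff hw.aestronglyMeasurable hT.aemeasurable).2 hwT
    rw [← hL g g (Filter.EventuallyEq.refl _ _), ← hL w (hwL.toLp w) hwL.coeFn_toLp]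
    exact hmin _
  · have htop : eLpNorm (w ∘ T - f) 2 μ = ⊤ := by
      by_contra hne
      exact hfin ⟨(hw.comp hT).aestronglyMeasurable.sub hf.1, lt_top_iff_ne_top.2 hne⟩
    rw [htop]
    exact le_top

/-- The joint law of `(t, X₁, X₀)` in the flow matching loss. -/
noncomputable def couplingLaw (p₀ p₁ : Measure (EuclideanSpace ℝ (Fin d))) :
    Measure (ℝ × EuclideanSpace ℝ (Fin d) × EuclideanSpace ℝ (Fin d)) :=
  (volume.restrict (Icc (0 : ℝ) 1)).prod (p₁.prod p₀)

/-- The map `(t, x₁, x₀) ↦ (t, (1 - t) x₀ + t x₁)`. -/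
noncomputable def timeInterp (z : ℝ × EuclideanSpace ℝ (Fin d) × EuclideanSpace ℝ (Fin d)) :
    ℝ × EuclideanSpace ℝ (Fin d) :=
  (z.1, otInterp z.1 z.2.2 z.2.1)

theorem measurable_timeInterp : Measurable (timeInterp (d := d)) := by
  unfold timeInterp otInterp
  fun_prop

theorem cfmLoss_eq {p₀ p₁ : Measure (EuclideanSpace ℝ (Fin d))} [SFinite p₀] [SFinite p₁]
    {v : ℝ → EuclideanSpace ℝ (Fin d) → EuclideanSpace ℝ (Fin d)}
    (hv : Measurable (Function.uncurry v)) :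
    cfmLoss p₀ p₁ v =
      eLpNorm (Function.uncurry v ∘ timeInterp - fun z => z.2.1 - z.2.2) 2
        (couplingLaw p₀ p₁) ^ (2 : ℝ) := by
  have hm : Measurable fun z : ℝ × EuclideanSpace ℝ (Fin d) × EuclideanSpace ℝ (Fin d) =>
      ‖v z.1 (otInterp z.1 z.2.2 z.2.1) - (z.2.1 - z.2.2)‖ₑ ^ 2 := by
    have h := hv.comp (measurable_timeInterp (d := d))
    have h' : Measurable fun z : ℝ × EuclideanSpace ℝ (Fin d) × EuclideanSpace ℝ (Fin d) =>
      z.2.1 - z.2.2 := by fun_prop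
    exact (h.sub h').enorm.pow_const 2
  have h := eLpNorm_nnreal_pow_eq_lintegral (μ := couplingLaw p₀ p₁) (p := 2)
    (f := Function.uncurry v ∘ timeInterp - fun z => z.2.1 - z.2.2) two_ne_zero
  simp only [NNReal.coe_ofNat, ENNReal.coe_ofNat] at h
  rw [h, couplingLaw]
  simp only [Pi.sub_apply, Function.comp_apply, timeInterp, Function.uncurry_apply_pair,
    ENNReal.rpow_ofNat]
  rw [lintegral_prod _ hm.aemeasurable, cfmLoss]
  refine lintegral_congr fun t => ?_
  exact (lintegral_prod _ (hm.comp measurable_prodMk_left).aemeasurable).symm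

theorem exists_isOptimalVelocity {p₀ p₁ : Measure (EuclideanSpace ℝ (Fin d))}
    [IsProbabilityMeasure p₀] [IsProbabilityMeasure p₁]
    {S U : Set (EuclideanSpace ℝ (Fin d))} (hS : IsCompact S) (hU : IsCompact U)
    (h₀ : ∀ᵐ x ∂p₀, x ∈ S) (h₁ : ∀ᵐ y ∂p₁, y ∈ U) :
    ∃ v, IsOptimalVelocity p₀ p₁ v := by
  obtain ⟨R₀, hR₀⟩ := hS.isBounded.exists_norm_le
  obtain ⟨R₁, hR₁⟩ := hU.isBounded.exists_norm_le
  have hf : MemLp (fun z : ℝ × EuclideanSpace ℝ (Fin d) × EuclideanSpace ℝ (Fin d) =>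
      z.2.1 - z.2.2) 2 (couplingLaw p₀ p₁) := by
    have : IsFiniteMeasure (couplingLaw p₀ p₁) := by
      unfold couplingLaw
      infer_instance
    refine MemLp.of_bound (by fun_prop) (R₁ + R₀) ?_
    have h : ∀ᵐ z ∂(p₁.prod p₀), z.1 ∈ U ∧ z.2 ∈ S :=
      (Measure.quasiMeasurePreserving_fst.ae h₁).and (Measure.quasiMeasurePreserving_snd.ae h₀)
    filter_upwards [Measure.quasiMeasurePreserving_snd.ae h] with z hz
    exact (norm_sub_le _ _).trans (add_le_add (hR₁ _ hz.1) (hR₀ _ hz.2))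
  obtain ⟨v, hv, hmin⟩ := exists_minimizer_eLpNorm_comp_sub measurable_timeInterp hf
  refine ⟨Function.curry v, by simpa using hv, fun w hw => ?_⟩
  rw [cfmLoss_eq (by simpa using hv), cfmLoss_eq hw, Function.uncurry_curry]
  exact ENNReal.rpow_le_rpow (hmin _ hw) zero_le_two

/-- The loss sees a velocity field only up to null sets of the law of `(t, X_t)`. -/
theorem IsOptimalVelocity.congr {p₀ p₁ : Measure (EuclideanSpace ℝ (Fin d))} [SFinite p₀]
    [SFinite p₁] {v w : ℝ → EuclideanSpace ℝ (Fin d) → EuclideanSpace ℝ (Fin d)}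
    (hv : IsOptimalVelocity p₀ p₁ v) (hw : Measurable (Function.uncurry w))
    (h : ∀ᵐ z ∂couplingLaw p₀ p₁,
      Function.uncurry v (timeInterp z) = Function.uncurry w (timeInterp z)) :
    IsOptimalVelocity p₀ p₁ w := by
  refine ⟨hw, fun u hu => ?_⟩
  have heq : cfmLoss p₀ p₁ w = cfmLoss p₀ p₁ v := by
    rw [cfmLoss_eq hw, cfmLoss_eq hv.1]
    congr 1
    refine eLpNorm_congr_ae ?_
    filter_upwards [h] with z hz
    simp [hz]
  exact heq.trans_le (hv.2 u hu)

/-! ### Optimal flows -/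

/-- If the same curve solves the ODE for two fields that differ by a fixed vector `e ≠ 0` on `N` and
agree elsewhere, the integrals over `[0, 1]` of the two velocities agree, so the curve spends no
time in `N`. -/
theorem SolvesODE.ae_notMem {v : ℝ → EuclideanSpace ℝ (Fin d) → EuclideanSpace ℝ (Fin d)}
    {N : Set (ℝ × EuclideanSpace ℝ (Fin d))} {e : EuclideanSpace ℝ (Fin d)} (he : e ≠ 0)
    {x : EuclideanSpace ℝ (Fin d)} {γ : ℝ → EuclideanSpace ℝ (Fin d)} (hv : SolvesODE v x γ)
    (hw : SolvesODE (fun t y => v t y + N.indicator (fun _ => (1 : ℝ)) (t, y) • e) x γ) :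
    ∀ᵐ s ∂volume.restrict (Icc (0 : ℝ) 1), (s, γ s) ∉ N := by
  set c : ℝ → ℝ := fun s => N.indicator (fun _ => (1 : ℝ)) (s, γ s) with hc
  have hint : IntervalIntegrable (fun s => c s • e) volume 0 1 := by
    simpa [hc] using hw.1.sub hv.1
  have hzero : ∫ s in (0 : ℝ)..1, c s • e = 0 := by
    have h1 := (hv.2 1 ⟨zero_le_one, le_rfl⟩).symm.trans (hw.2 1 ⟨zero_le_one, le_rfl⟩)
    rw [intervalIntegral.integral_add hv.1 hint, ← add_assoc] at h1
    exact left_eq_add.1 h1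
  rw [intervalIntegral.integral_smul_const, smul_eq_zero, or_iff_left he,
    intervalIntegral.integral_of_le zero_le_one, ← integral_Icc_eq_integral_Ioc] at hzero
  rw [intervalIntegrable_iff_integrableOn_Icc_of_le zero_le_one] at hint
  have hcint : Integrable c (volume.restrict (Icc (0 : ℝ) 1)) :=
    (integrable_smul_const he).1 hint
  have hnn : 0 ≤ c := fun s => indicator_nonneg (fun _ _ => zero_le_one) _
  filter_upwards [(integral_eq_zero_iff_of_nonneg hnn hcint).1 hzero] with s hs hmem
  simp [hc, hmem] at hs

/-- Almost every curve of an optimal flow spends no time in a null set of the law of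
`(t, X_t)`. -/
theorem IsOptimalFlow.ae_ae_notMem [NeZero d] {p₀ p₁ : Measure (EuclideanSpace ℝ (Fin d))}
    [SFinite p₀] [SFinite p₁]
    {φ : ℝ → EuclideanSpace ℝ (Fin d) → EuclideanSpace ℝ (Fin d)} (hφ : IsOptimalFlow p₀ p₁ φ)
    {v : ℝ → EuclideanSpace ℝ (Fin d) → EuclideanSpace ℝ (Fin d)}
    (hv : IsOptimalVelocity p₀ p₁ v) {N : Set (ℝ × EuclideanSpace ℝ (Fin d))}
    (hN : MeasurableSet N) (hnull : ∀ᵐ z ∂couplingLaw p₀ p₁, timeInterp z ∉ N) :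
    ∀ᵐ x ∂p₀, ∀ᵐ s ∂volume.restrict (Icc (0 : ℝ) 1), (s, φ s x) ∉ N := by
  obtain ⟨e, he⟩ := exists_ne (0 : EuclideanSpace ℝ (Fin d))
  have hw : IsOptimalVelocity p₀ p₁
      (fun t y => v t y + N.indicator (fun _ => (1 : ℝ)) (t, y) • e) := by
    refine hv.congr (hv.1.add ((measurable_const.indicator hN).smul_const e)) ?_
    filter_upwards [hnull] with z hz
    simp only [Function.uncurry_def, Prod.mk.eta, indicator_of_notMem hz, zero_smul, add_zero]
  filter_upwards [hφ _ hv, hφ _ hw] with x hx hx'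
  exact hx.ae_notMem he hx'

theorem IsOptimalFlow.ae_forall_mem_region {p₀ p₁ : Measure (EuclideanSpace ℝ (Fin d))}
    [IsProbabilityMeasure p₀] [IsProbabilityMeasure p₁]
    {S U : Set (EuclideanSpace ℝ (Fin d))} (hS : IsCompact S) (hU : IsCompact U)
    (h₀ : ∀ᵐ x ∂p₀, x ∈ S) (h₁ : ∀ᵐ y ∂p₁, y ∈ U)
    {φ : ℝ → EuclideanSpace ℝ (Fin d) → EuclideanSpace ℝ (Fin d)}
    (hφ : IsOptimalFlow p₀ p₁ φ) :
    ∀ᵐ x ∂p₀, ContinuousOn (fun t => φ t x) (Icc 0 1) ∧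
      ∀ t ∈ Icc (0 : ℝ) 1, φ t x ∈ region S U t := by
  obtain ⟨v, hv⟩ := exists_isOptimalVelocity hS hU h₀ h₁
  have htube : ∀ᵐ z ∂couplingLaw p₀ p₁, timeInterp z ∈ tube S U := by
    have h : ∀ᵐ z ∂(p₁.prod p₀), z.1 ∈ U ∧ z.2 ∈ S :=
      (Measure.quasiMeasurePreserving_fst.ae h₁).and (Measure.quasiMeasurePreserving_snd.ae h₀)
    filter_upwards [Measure.quasiMeasurePreserving_snd.ae h,
      Measure.quasiMeasurePreserving_fst.ae (ae_restrict_mem measurableSet_Icc)] with z hz hz'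
    exact ⟨hz', mem_region.2 ⟨_, hz.2, _, hz.1, rfl⟩⟩
  have hclosed : IsClosed (tube S U) := (isCompact_tube hS hU).isClosed
  rcases Nat.eq_zero_or_pos d with rfl | hd
  · -- In dimension `0` there is no vector `e ≠ 0`, but a region is all of space once it is nonempty.
    obtain ⟨x₀, hx₀⟩ := h₀.exists
    obtain ⟨x₁, hx₁⟩ := h₁.exists
    filter_upwards [hφ v hv] with x hx
    exact ⟨hx.continuousOn, fun t _ => mem_region.2 ⟨x₀, hx₀, x₁, hx₁, Subsingleton.elim _ _⟩⟩
  · have : NeZero d := ⟨hd.ne'⟩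
    filter_upwards [hφ v hv, hφ.ae_ae_notMem hv hclosed.measurableSet.compl
      (htube.mono fun z hz => not_not.2 hz)] with x hx hx'
    refine ⟨hx.continuousOn, fun t ht => ?_⟩
    exact (forall_mem_of_ae_mem_of_isClosed hx.continuousOn hclosed
      (hx'.mono fun s hs => not_not.1 hs) t ht).2

end FlowMatching

theorem mainTheorem5 (d : ℕ) {I : Type*} [Finite I] {J : I → Type*} [∀ i, Finite (J i)]
    (C : (i : I) → J i → Set (EuclideanSpace ℝ (Fin d)))
    (hCcompact : ∀ i j, IsCompact (C i j))
    (hCconvex : ∀ i j, Convex ℝ (C i j))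
    (hCdisj : Pairwise fun p q : (Σ i, J i) => Disjoint (C p.1 p.2) (C q.1 q.2))
    (hHull : Pairwise fun i i' : I =>
      Disjoint (FlowMatching.groupHull C i) (FlowMatching.groupHull C i'))
    (S : Set (EuclideanSpace ℝ (Fin d))) (hScompact : IsCompact S) (hSconvex : Convex ℝ S) :
    ∃ t₁ ∈ Ioo (0 : ℝ) 1, ∃ t₂ ∈ Ioo t₁ 1,
      (∀ t ∈ Ioc t₁ 1,
        (∀ i, Convex ℝ (FlowMatching.region S (FlowMatching.groupHull C i) t)) ∧
        Pairwise fun i i' : I =>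
          Disjoint (FlowMatching.region S (FlowMatching.groupHull C i) t)
            (FlowMatching.region S (FlowMatching.groupHull C i') t)) ∧
      (∀ t ∈ Ioc t₂ 1,
        (∀ i j, Convex ℝ (FlowMatching.region S (C i j) t)) ∧
        Pairwise fun p q : (Σ i, J i) =>
          Disjoint (FlowMatching.region S (C p.1 p.2) t)
            (FlowMatching.region S (C q.1 q.2) t)) ∧
      ∀ (p₀ p₁ : Measure (EuclideanSpace ℝ (Fin d))) [IsProbabilityMeasure p₀]
        [IsProbabilityMeasure p₁],
        (∀ᵐ x ∂p₀, x ∈ S) → (∀ᵐ y ∂p₁, y ∈ ⋃ i, ⋃ j, C i j) →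
        ∀ φ : ℝ → EuclideanSpace ℝ (Fin d) → EuclideanSpace ℝ (Fin d),
          FlowMatching.IsOptimalFlow p₀ p₁ φ →
          ∀ᵐ x ∂p₀,
            (∀ i, φ t₁ x ∈ FlowMatching.region S (FlowMatching.groupHull C i) t₁ →
              (∀ t ∈ Ioc t₁ 1, φ t x ∈ FlowMatching.region S (FlowMatching.groupHull C i) t) ∧
              φ 1 x ∈ FlowMatching.groupHull C i) ∧
            (∀ i j, φ t₂ x ∈ FlowMatching.region S (C i j) t₂ →
              (∀ t ∈ Ioc t₂ 1, φ t x ∈ FlowMatching.region S (C i j) t) ∧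
              φ 1 x ∈ C i j) := by
  have hHullC : ∀ i, IsCompact (FlowMatching.groupHull C i) := fun i =>
    FlowMatching.isCompact_convexHull_iUnion (hCcompact i) (hCconvex i)
  obtain ⟨t₁, ht₁, hd₁⟩ := FlowMatching.exists_forall_Icc_of_eventually_nhds_one
    (FlowMatching.eventually_pairwise_disjoint_region hScompact hHullC hHull) zero_lt_one
  obtain ⟨t₂, ht₂, hd₂⟩ := FlowMatching.exists_forall_Icc_of_eventually_nhds_one
    (FlowMatching.eventually_pairwise_disjoint_region hScompact
      (K := fun p : Σ i, J i => C p.1 p.2) (fun p => hCcompact p.1 p.2) hCdisj) ht₁.2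
  refine ⟨t₁, ht₁, t₂, ht₂, fun t ht => ⟨fun i => ?_, hd₁ t (Ioc_subset_Icc_self ht)⟩,
    fun t ht => ⟨fun i j => ?_, hd₂ t (Ioc_subset_Icc_self ht)⟩, ?_⟩
  · exact FlowMatching.convex_region hSconvex (convex_convexHull ℝ _) t
  · exact FlowMatching.convex_region hSconvex (hCconvex i j) t
  intro p₀ p₁ _ _ h₀ h₁ φ hφ
  have hU : IsCompact (⋃ i, ⋃ j, C i j) :=
    isCompact_iUnion fun i => isCompact_iUnion fun j => hCcompact i j
  filter_upwards [hφ.ae_forall_mem_region hScompact hU h₀ h₁] with x hx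
  obtain ⟨hcont, hmem⟩ := hx
  have hsub₁ : (⋃ i, ⋃ j, C i j) ⊆ ⋃ i, FlowMatching.groupHull C i :=
    iUnion_mono fun i => subset_convexHull ℝ _
  have hsub₂ : (⋃ i, ⋃ j, C i j) ⊆ ⋃ p : Σ i, J i, C p.1 p.2 := by
    rw [iUnion_sigma]
  constructor
  · intro i hi
    have key : ∀ t ∈ Icc t₁ 1, φ t x ∈ FlowMatching.region S (FlowMatching.groupHull C i) t :=
      fun t ht => FlowMatching.mem_region_of_continuousOn hScompact hHullC ht₁.1.le hd₁ hcont
        (fun s hs => FlowMatching.region_mono hsub₁ s (hmem s hs)) hi ht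
    exact ⟨fun t ht => key t (Ioc_subset_Icc_self ht),
      FlowMatching.region_one_subset _ _ (key 1 ⟨ht₁.2.le, le_rfl⟩)⟩
  · intro i j hij
    have key : ∀ t ∈ Icc t₂ 1, φ t x ∈ FlowMatching.region S (C i j) t :=
      fun t ht => FlowMatching.mem_region_of_continuousOn hScompact
        (K := fun p : Σ i, J i => C p.1 p.2) (fun p => hCcompact p.1 p.2)
        (ht₁.1.trans ht₂.1).le hd₂ hcont
        (fun s hs => FlowMatching.region_mono hsub₂ s (hmem s hs)) (k := ⟨i, j⟩) hij ht
    exact ⟨fun t ht => key t (Ioc_subset_Icc_self ht),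
      FlowMatching.region_one_subset _ _ (key 1 ⟨ht₂.2.le, le_rfl⟩)⟩
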